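/- Fix an infinite set $\mathsf{At}$ from which atomic propositions are drawn. A *transition system* is a tuple $\mathcal T=(S,\to,I,\mathsf{AP},L)$ with a non-empty set $S$ of states, a relation $\to\,\subseteq S\times S$ such that every state has a successor, a set $I\subseteq S$ of initial states, a set $\mathsf{AP}\subseteq\mathsf{At}$ and a labeling $L\colon S\to 2^{\mathsf{AP}}$. CTL state formulas over $\mathsf{At}$ are interpreted at states as usual, and $\mathcal T\vDash\Phi$ means that all initial states of $\mathcal T$ satisfy $\Phi$. A set of transition systems is *CTL-definable* if it is a finite Boolean combination of sets of the form $\{\mathcal T\mid\mathcal T\vDash\Phi\}$ with $\Phi$ a CTL state formula. A system $\mathcal T_2$ is a *refinement* of $\mathcal T_1$, written $\mathcal T_1\rightsquigarrow\mathcal T_2$, if $\mathsf{AP}_1=\mathsf{AP}_2$ and there is a surjection $f\colon S_2\to S_1$ such that $L_1(f(s))=L_2(s)$ for all $s\in S_2$; $\to_1$ is the smallest relation with $f(s)\to_1 f(s')$ whenever $s\to_2 s'$; and $I_1=f(I_2)$. Modal formulas are given by $\varphi::=\top\mid p\mid\varphi\land\varphi\mid\neg\varphi\mid\Diamond\varphi$,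 with $p$ from a countably infinite set of variables, and $\Box=\neg\Diamond\neg$. Let $\mathsf{MLAR}$ be the set of all modal formulas that are true at every world of the class of all transition systems, with accessibility relation $\rightsquigarrow$, under every valuation that assigns to each variable a CTL-definable set. Let $\mathsf{S4.2.1}$ be the smallest normal modal logic containing $p\to\Diamond p$, $\Diamond\Diamond p\to\Diamond p$, $\Diamond\Box p\to\Box\Diamond p$ and $\Box\Diamond p\to\Diamond\Box p$; here a normal modal logic is a set of modal formulas that contains all propositional tautologies, $\Box(p\to q)\to(\Box p\to\Box q)$ and $\Diamond p\leftrightarrow\neg\Box\neg p$, and is closed under modus ponens, uniform substitution and generalization (from $\varphi$ infer $\Box\varphi$). **Theorem.** $\mathsf{MLAR}\subseteq\mathsf{S4.2.1}$. -/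

import Mathlib

universe u v

namespace AbstractionRefinement

/-! ### Modal formulas, normal modal logics and the logic S4.2.1 -/

/-- Modal formulas over the countably infinite set `ℕ` of propositional variables. -/
inductive ModalFormula : Type
  | top : ModalFormula
  | var : ℕ → ModalFormula
  | and : ModalFormula → ModalFormula → ModalFormula
  | neg : ModalFormula → ModalFormula
  | dia : ModalFormula → ModalFormula

namespace ModalFormula

/-- `φ → ψ` as an abbreviation. -/
def imp (φ ψ : ModalFormula) : ModalFormula := neg (and φ (neg ψ))

/-- `φ ↔ ψ` as an abbreviation. -/
def iff (φ ψ : ModalFormula) : ModalFormula := and (imp φ ψ) (imp ψ φ)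

/-- `□ φ = ¬ ◇ ¬ φ`. -/
def box (φ : ModalFormula) : ModalFormula := neg (dia (neg φ))

/-- `φ.subst p χ` replaces every occurrence of the variable `p` in `φ` by `χ`. -/
def subst (p : ℕ) (χ : ModalFormula) : ModalFormula → ModalFormula
  | top => top
  | var q => if q = p then χ else var q
  | and φ ψ => and (subst p χ φ) (subst p χ ψ)
  | neg φ => neg (subst p χ φ)
  | dia φ => dia (subst p χ φ)

/-- Propositional tautologies: true under all truth assignments that respect `⊤`, `∧` and `¬`,
where variables and formulas `◇ φ` may receive arbitrary truth values. -/
def IsTautology (φ : ModalFormula) : Prop :=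
  ∀ t : ModalFormula → Prop, t top → (∀ α β, t (and α β) ↔ t α ∧ t β) →
    (∀ α, t (neg α) ↔ ¬ t α) → t φ

/-- The axiom `□ (p → q) → (□ p → □ q)`. -/
def axiomK : ModalFormula :=
  imp (box (imp (var 0) (var 1))) (imp (box (var 0)) (box (var 1)))

/-- The duality axiom `◇ p ↔ ¬ □ ¬ p`. -/
def axiomDual : ModalFormula := iff (dia (var 0)) (neg (box (neg (var 0))))

/-- The axiom `p → ◇ p`. -/
def axiomT : ModalFormula := imp (var 0) (dia (var 0))

/-- The axiom `◇ ◇ p → ◇ p`. -/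
def axiomFour : ModalFormula := imp (dia (dia (var 0))) (dia (var 0))

/-- The axiom (.2), `◇ □ p → □ ◇ p`. -/
def axiomDotTwo : ModalFormula := imp (dia (box (var 0))) (box (dia (var 0)))

/-- The axiom (.1), `□ ◇ p → ◇ □ p`. -/
def axiomDotOne : ModalFormula := imp (box (dia (var 0))) (dia (box (var 0)))

end ModalFormula

open ModalFormula in
/-- Normal modal logics. Since `◇` is the primitive operator and `□` abbreviates `¬ ◇ ¬`, the
duality axiom belongs to the definition, as usual. -/
structure IsNormalModalLogic (Λ : Set ModalFormula) : Prop where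
  tautology : ∀ φ, IsTautology φ → φ ∈ Λ
  K : axiomK ∈ Λ
  dual : axiomDual ∈ Λ
  modusPonens : ∀ φ ψ, φ ∈ Λ → imp φ ψ ∈ Λ → ψ ∈ Λ
  substitution : ∀ φ p χ, φ ∈ Λ → subst p χ φ ∈ Λ
  generalization : ∀ φ, φ ∈ Λ → box φ ∈ Λ

/-- The smallest normal modal logic that contains `Γ`. -/
def smallestNormalModalLogic (Γ : Set ModalFormula) : Set ModalFormula :=
  ⋂₀ {Λ | IsNormalModalLogic Λ ∧ Γ ⊆ Λ}

/-- The logic `S4.2.1 = K + (T) + (4) + (.2) + (.1)`. -/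
def S4_2_1 : Set ModalFormula :=
  smallestNormalModalLogic
    {ModalFormula.axiomT, ModalFormula.axiomFour, ModalFormula.axiomDotTwo,
      ModalFormula.axiomDotOne}

/-! ### General Kripke frames -/

/-- `Forces R V w φ`: the formula `φ` is true at the world `w` of the Kripke model with
accessibility relation `R` and valuation `V`. -/
def Forces {W : Type u} (R : W → W → Prop) (V : ℕ → Set W) : W → ModalFormula → Prop
  | _, .top => True
  | w, .var p => w ∈ V p
  | w, .and φ ψ => Forces R V w φ ∧ Forces R V w ψ
  | w, .neg φ => ¬ Forces R V w φ
  | w, .dia φ => ∃ w', R w w' ∧ Forces R V w' φ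

/-- General Kripke frames: the admissible sets of worlds are closed under complements and finite
unions. -/
structure GeneralFrame where
  World : Type u
  nonempty : Nonempty World
  rel : World → World → Prop
  admissible : BooleanSubalgebra (Set World)

/-- The set of formulas that are true at all worlds under all admissible valuations. -/
def GeneralFrame.logic (G : GeneralFrame.{u}) : Set ModalFormula :=
  {φ | ∀ V : ℕ → Set G.World, (∀ p, V p ∈ G.admissible) → ∀ w, Forces G.rel V w φ}

/-! ### Transition systems, CTL and refinement -/

/-- Transition systems without terminal states. The set `AP` of atomic propositions is part of
the system; it is drawn from the supply `Atom`. -/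
structure TransitionSystem (Atom : Type v) where
  State : Type u
  nonempty : Nonempty State
  trans : State → State → Prop
  init : Set State
  AP : Set Atom
  label : State → Set Atom
  label_subset : ∀ s, label s ⊆ AP
  exists_trans : ∀ s, ∃ t, trans s t

mutual

/-- CTL state formulas. -/
inductive StateFormula (Atom : Type v) : Type v
  | top : StateFormula Atom
  | atom : Atom → StateFormula Atom
  | and : StateFormula Atom → StateFormula Atom → StateFormula Atom
  | neg : StateFormula Atom → StateFormula Atom
  | ex : PathFormula Atom → StateFormula Atom
  | all : PathFormula Atom → StateFormula Atom

/-- CTL path formulas: `next Φ` is `X Φ` and `untl Φ Ψ` is `Φ U Ψ`. -/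
inductive PathFormula (Atom : Type v) : Type v
  | next : StateFormula Atom → PathFormula Atom
  | untl : StateFormula Atom → StateFormula Atom → PathFormula Atom

end

namespace TransitionSystem

variable {Atom : Type v}

/-- The infinite paths of `T` that start in `s`. -/
def paths (T : TransitionSystem.{u, v} Atom) (s : T.State) : Set (ℕ → T.State) :=
  {π | π 0 = s ∧ ∀ i, T.trans (π i) (π (i + 1))}

mutual

/-- Satisfaction of CTL state formulas at states. -/
def SatState (T : TransitionSystem.{u, v} Atom) : StateFormula Atom → T.State → Prop
  | .top, _ => True
  | .atom a, s => a ∈ T.label s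
  | .and Φ Ψ, s => SatState T Φ s ∧ SatState T Ψ s
  | .neg Φ, s => ¬ SatState T Φ s
  | .ex φ, s => ∃ π ∈ T.paths s, SatPath T φ π
  | .all φ, s => ∀ π ∈ T.paths s, SatPath T φ π

/-- Satisfaction of CTL path formulas on paths. -/
def SatPath (T : TransitionSystem.{u, v} Atom) : PathFormula Atom → (ℕ → T.State) → Prop
  | .next Φ, π => SatState T Φ (π 1)
  | .untl Φ Ψ, π => ∃ j, SatState T Ψ (π j) ∧ ∀ i < j, SatState T Φ (π i)

end

/-- A transition system satisfies a CTL state formula if all its initial states do. -/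
def Sat (T : TransitionSystem.{u, v} Atom) (Φ : StateFormula Atom) : Prop :=
  ∀ s ∈ T.init, T.SatState Φ s

/-- `Refines T₁ T₂`: the system `T₂` is a refinement of `T₁`, witnessed by an abstraction function
`f`. The transition relation of `T₁` is the image of that of `T₂`, which is the smallest relation
such that `f` preserves transitions. -/
def Refines (T₁ T₂ : TransitionSystem.{u, v} Atom) : Prop :=
  T₁.AP = T₂.AP ∧ ∃ f : T₂.State → T₁.State, Function.Surjective f ∧
    (∀ s, T₁.label (f s) = T₂.label s) ∧
    T₁.trans = Relation.Map T₂.trans f f ∧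
    T₁.init = f '' T₂.init

end TransitionSystem

/-! ### The modal logic of abstraction refinement -/

/-- The sets of transition systems that are expressed by a single CTL state formula. -/
def ctlExpressible (Atom : Type v) : Set (Set (TransitionSystem.{u, v} Atom)) :=
  {P | ∃ Φ : StateFormula Atom, P = {T | T.Sat Φ}}

/-- The general frame of all transition systems with the refinement relation. The admissible sets
are the CTL-definable ones: finite Boolean combinations of sets expressed by CTL state formulas.
(As all initial states have to satisfy a formula, `T.Sat (.neg Φ)` is not the negation of
`T.Sat Φ`, so the closure under complements has to be taken here.) -/
def refinementFrame (Atom : Type v) : GeneralFrame where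
  World := TransitionSystem.{u, v} Atom
  nonempty := ⟨⟨PUnit, ⟨⟨⟩⟩, fun _ _ => True, ∅, ∅, fun _ => ∅, fun _ => subset_rfl,
    fun s => ⟨s, trivial⟩⟩⟩
  rel := TransitionSystem.Refines
  admissible := BooleanSubalgebra.closure (ctlExpressible.{u, v} Atom)

/-- The modal logic of abstraction refinement on the class of all transition systems (with state
sets in the universe `u` and atomic propositions from `Atom`). -/
def MLAR (Atom : Type v) : Set ModalFormula :=
  (refinementFrame.{u, v} Atom).logic

end AbstractionRefinement

-- The proof is by contraposition. A formula outside S4.2.1 fails at the root of a finite preorder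
-- with a greatest world that sees only itself (`exists_finite_countermodel`). In the canonical
-- model, the formulas φ with ◇□φ at the root form a complete consistent theory: (.2) gives closure
-- under conjunction and consistency, (.1) gives completeness. This theory labels a new greatest
-- world, which is placed on top of a transitive filtration.
--
-- Such a frame W is then simulated by refinement. A map `c` from transition systems to W is built
-- that is a bounded morphism with CTL-definable preimages and has the root as a value; truth under
-- admissible valuations then transfers to W (`forces_of_mem_logic`). Each world gives a button,
-- which refinement can never release (`Refines.buttons_subset`), and a switch. The pushed buttons,
-- as long as they form a chain, determine a cluster of W, and the switches choose a world in it; if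
-- they form no chain, the value is the greatest world. The refinement `push` adds one chosen button
-- and leaves exactly the matching switch active, which gives the back condition. It needs a good
-- initial state; without one all buttons are pushed vacuously, and the value is already the
-- greatest world.

namespace AbstractionRefinement

open Filter

-- Truth assignments, subformulas and a Lindenbaum lemma

namespace ModalFormula

/-- Truth assignments that respect the Boolean connectives. -/
structure IsTruth (t : ModalFormula → Prop) : Prop where
  top : t top
  and : ∀ α β, t (and α β) ↔ t α ∧ t β
  neg : ∀ α, t (neg α) ↔ ¬ t α

theorem IsTruth.imp {t : ModalFormula → Prop} (h : IsTruth t) (α β : ModalFormula) :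
    t (imp α β) ↔ (t α → t β) := by
  simp only [ModalFormula.imp, h.neg, h.and]; tauto

theorem IsTruth.iff {t : ModalFormula → Prop} (h : IsTruth t) (α β : ModalFormula) :
    t (iff α β) ↔ (t α ↔ t β) := by
  simp only [ModalFormula.iff, h.imp, h.and]; tauto

/-- Only finitely many variables occur in a formula. -/
theorem exists_forall_subst_eq_self (φ : ModalFormula) :
    ∃ N, ∀ n, N ≤ n → ∀ χ, subst n χ φ = φ := by
  induction φ with
  | top => exact ⟨0, fun _ _ _ => rfl⟩
  | var q =>
    refine ⟨q + 1, fun n hn χ => ?_⟩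
    have : q ≠ n := by omega
    simp [subst, this]
  | and φ ψ hφ hψ =>
    obtain ⟨N, hN⟩ := hφ
    obtain ⟨M, hM⟩ := hψ
    exact ⟨max N M, fun n hn χ => by
      simp [subst, hN n (le_trans (le_max_left _ _) hn), hM n (le_trans (le_max_right _ _) hn)]⟩
  | neg φ hφ =>
    obtain ⟨N, hN⟩ := hφ
    exact ⟨N, fun n hn χ => by simp [subst, hN n hn]⟩
  | dia φ hφ =>
    obtain ⟨N, hN⟩ := hφ
    exact ⟨N, fun n hn χ => by simp [subst, hN n hn]⟩

/-- Every formula lies in a finite set that is closed under subformulas. -/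
theorem exists_finite_subformula_closed (φ : ModalFormula) :
    ∃ S : Set ModalFormula, S.Finite ∧ φ ∈ S ∧
      (∀ α β, and α β ∈ S → α ∈ S ∧ β ∈ S) ∧ (∀ α, neg α ∈ S → α ∈ S) ∧
      (∀ α, dia α ∈ S → α ∈ S) := by
  induction φ with
  | top => exact ⟨{top}, by simp⟩
  | var q => exact ⟨{var q}, by simp⟩
  | and φ ψ hφ hψ =>
    obtain ⟨S, fS, mS, aS, nS, dS⟩ := hφ
    obtain ⟨T, fT, mT, aT, nT, dT⟩ := hψ
    refine ⟨insert (and φ ψ) (S ∪ T), (fS.union fT).insert _, by simp, ?_, ?_, ?_⟩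
    · rintro α β (h | h | h)
      · cases h; simp [mS, mT]
      · simp [aS _ _ h]
      · simp [aT _ _ h]
    · rintro α (h | h | h)
      · cases h
      · simp [nS _ h]
      · simp [nT _ h]
    · rintro α (h | h | h)
      · cases h
      · simp [dS _ h]
      · simp [dT _ h]
  | neg φ hφ =>
    obtain ⟨S, fS, mS, aS, nS, dS⟩ := hφ
    refine ⟨insert (neg φ) S, fS.insert _, by simp, ?_, ?_, ?_⟩
    · rintro α β (h | h)
      · cases h
      · simp [aS _ _ h]
    · rintro α (h | h)
      · cases h; simp [mS]
      · simp [nS _ h]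
    · rintro α (h | h)
      · cases h
      · simp [dS _ h]
  | dia φ hφ =>
    obtain ⟨S, fS, mS, aS, nS, dS⟩ := hφ
    refine ⟨insert (dia φ) S, fS.insert _, by simp, ?_, ?_, ?_⟩
    · rintro α β (h | h)
      · cases h
      · simp [aS _ _ h]
    · rintro α (h | h)
      · cases h
      · simp [nS _ h]
    · rintro α (h | h)
      · cases h; simp [mS]
      · simp [dS _ h]

/-- A Lindenbaum lemma: a set of formulas that contains the tautologies and is closed under modus
ponens is the intersection of the truth assignments that satisfy it. -/
theorem exists_isTruth_of_notMem {Γ : Set ModalFormula} (taut : ∀ φ, IsTautology φ → φ ∈ Γ)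
    (mp : ∀ φ ψ, φ ∈ Γ → imp φ ψ ∈ Γ → ψ ∈ Γ) {φ : ModalFormula} (hφ : φ ∉ Γ) :
    ∃ t, IsTruth t ∧ (∀ γ ∈ Γ, t γ) ∧ ¬ t φ := by
  have and_mem : ∀ α ∈ Γ, ∀ β ∈ Γ, and α β ∈ Γ := by
    intro α hα β hβ
    refine mp _ _ hβ (mp _ _ hα (taut _ fun t h1 h2 h3 => ?_))
    have h : IsTruth t := ⟨h1, h2, h3⟩
    simp only [h.imp, h.and]
    tauto
  -- Compactness by an ultraproduct: the sets `s γ` are nonempty, since otherwise γ → φ would be a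
  -- tautology, and they are directed by conjunction. Truth along an ultrafilter containing them
  -- again respects the connectives.
  let A := {t : ModalFormula → Prop // IsTruth t}
  let s : Γ → Set A := fun γ => {t | t.1 γ ∧ ¬ t.1 φ}
  have hs : ∀ γ, (s γ).Nonempty := by
    intro γ
    by_contra hne
    refine hφ (mp _ _ γ.2 (taut _ fun t h1 h2 h3 => ?_))
    have h : IsTruth t := ⟨h1, h2, h3⟩
    rw [h.imp]
    intro hγ
    by_contra ht
    exact hne ⟨⟨t, h⟩, hγ, ht⟩
  have top_mem : top ∈ Γ := taut _ fun t h _ _ => h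
  have : Nonempty Γ := ⟨⟨top, top_mem⟩⟩
  have : NeBot (⨅ γ, 𝓟 (s γ)) := by
    refine iInf_neBot_of_directed' ?_ fun γ => principal_neBot_iff.2 (hs γ)
    intro α β
    refine ⟨⟨and α β, and_mem _ α.2 _ β.2⟩, ?_, ?_⟩ <;>
    · refine principal_mono.2 fun t ht => ?_
      have := (t.2.and _ _).1 ht.1
      exact ⟨by tauto, ht.2⟩
  let U := Ultrafilter.of (⨅ γ, 𝓟 (s γ))
  have hU : ∀ γ, ∀ᶠ t in (U : Filter A), t ∈ s γ := fun γ =>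
    Ultrafilter.of_le _ (mem_iInf_of_mem γ (mem_principal_self _))
  refine ⟨fun ψ => ∀ᶠ t in (U : Filter A), t.1 ψ, ⟨?_, ?_, ?_⟩, ?_, ?_⟩
  · exact Eventually.of_forall fun t => t.2.top
  · intro α β
    simp only [← eventually_and]
    exact eventually_congr (Eventually.of_forall fun t => t.2.and α β)
  · intro α
    rw [← Ultrafilter.eventually_not]
    exact eventually_congr (Eventually.of_forall fun t => t.2.neg α)
  · exact fun γ hγ => (hU ⟨γ, hγ⟩).mono fun t ht => ht.1
  · rw [← Ultrafilter.eventually_not]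
    exact (hU ⟨top, top_mem⟩).mono fun t ht => ht.2

end ModalFormula

open ModalFormula

-- The canonical model of a normal modal logic

namespace IsNormalModalLogic

variable {Λ : Set ModalFormula}

theorem K_mem (hΛ : IsNormalModalLogic Λ) (α β : ModalFormula) :
    imp (box (imp α β)) (imp (box α) (box β)) ∈ Λ := by
  obtain ⟨N, hN⟩ := exists_forall_subst_eq_self α
  -- Substitution acts on one variable at a time, and α may contain variable 1. So variable 1 is
  -- first renamed to `N + 1`, which does not occur in α and differs from 0.
  have h := hΛ.substitution _ (N + 1) β (hΛ.substitution _ 0 α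
    (hΛ.substitution _ 1 (var (N + 1)) hΛ.K))
  simpa [axiomK, imp, box, subst, hN (N + 1) (Nat.le_succ N)] using h

theorem dual_mem (hΛ : IsNormalModalLogic Λ) (α : ModalFormula) :
    iff (dia α) (neg (box (neg α))) ∈ Λ := by
  simpa [axiomDual, iff, imp, box, subst] using hΛ.substitution _ 0 α hΛ.dual

end IsNormalModalLogic

/-- The worlds of the canonical model of `Λ`. -/
structure IsWorld (Λ : Set ModalFormula) (t : ModalFormula → Prop) : Prop extends IsTruth t where
  of_mem : ∀ φ ∈ Λ, t φ

/-- The accessibility relation of the canonical model. -/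
def CanonicalRel (w v : ModalFormula → Prop) : Prop := ∀ φ, w (box φ) → v φ

namespace IsWorld

variable {Λ : Set ModalFormula} {w v : ModalFormula → Prop}

theorem dia_iff_not_box (hΛ : IsNormalModalLogic Λ) (hw : IsWorld Λ w) (φ : ModalFormula) :
    w (dia φ) ↔ ¬ w (box (neg φ)) := by
  have := hw.of_mem _ (hΛ.dual_mem φ)
  rwa [hw.iff, hw.neg] at this

theorem dia_iff (hΛ : IsNormalModalLogic Λ) (hw : IsWorld Λ w) (φ : ModalFormula) :
    w (dia φ) ↔ ∃ v, IsWorld Λ v ∧ CanonicalRel w v ∧ v φ := by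
  rw [hw.dia_iff_not_box hΛ]
  constructor
  · intro h
    -- By generalization and axiom K, the formulas necessary at `w` contain the tautologies and are
    -- closed under modus ponens.
    obtain ⟨v, tv, hv, hvφ⟩ := exists_isTruth_of_notMem (Γ := {χ | w (box χ)})
      (fun χ hχ => hw.of_mem _ (hΛ.generalization _ (hΛ.tautology _ hχ)))
      (fun α β hα hαβ => by
        have := hw.of_mem _ (hΛ.K_mem α β)
        rw [hw.imp, hw.imp] at this
        exact this hαβ hα) h
    rw [tv.neg, not_not] at hvφ
    exact ⟨v, ⟨tv, fun χ hχ => hv χ (hw.of_mem _ (hΛ.generalization _ hχ))⟩, hv, hvφ⟩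
  · rintro ⟨v, hv, hwv, hvφ⟩ h
    exact (hv.neg _).1 (hwv _ h) hvφ

theorem box_iff (hΛ : IsNormalModalLogic Λ) (hw : IsWorld Λ w) (φ : ModalFormula) :
    w (box φ) ↔ ∀ v, IsWorld Λ v → CanonicalRel w v → v φ := by
  rw [box, hw.neg, hw.dia_iff hΛ]
  push Not
  refine forall_congr' fun v => forall_congr' fun hv => forall_congr' fun _ => ?_
  rw [hv.neg, not_not]

end IsWorld

theorem isNormalModalLogic_smallestNormalModalLogic (Γ : Set ModalFormula) :
    IsNormalModalLogic (smallestNormalModalLogic Γ) where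
  tautology φ h _ hΛ := hΛ.1.tautology φ h
  K _ hΛ := hΛ.1.K
  dual _ hΛ := hΛ.1.dual
  modusPonens φ ψ h h' Λ hΛ := hΛ.1.modusPonens φ ψ (h Λ hΛ) (h' Λ hΛ)
  substitution φ p χ h Λ hΛ := hΛ.1.substitution φ p χ (h Λ hΛ)
  generalization φ h Λ hΛ := hΛ.1.generalization φ (h Λ hΛ)

theorem subset_smallestNormalModalLogic (Γ : Set ModalFormula) :
    Γ ⊆ smallestNormalModalLogic Γ := fun _ h _ hΛ => hΛ.2 h

-- Completeness of S4.2.1 for finite frames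

namespace S4_2_1

theorem normal : IsNormalModalLogic S4_2_1 := isNormalModalLogic_smallestNormalModalLogic _

variable {w v : ModalFormula → Prop}

theorem T (hw : IsWorld S4_2_1 w) {φ : ModalFormula} (h : w φ) : w (dia φ) := by
  have := hw.of_mem _ (normal.substitution _ 0 φ
    (subset_smallestNormalModalLogic _ (by simp : axiomT ∈ _)))
  exact (hw.imp _ _).1 this h

theorem four (hw : IsWorld S4_2_1 w) {φ : ModalFormula} (h : w (dia (dia φ))) : w (dia φ) := by
  have := hw.of_mem _ (normal.substitution _ 0 φ
    (subset_smallestNormalModalLogic _ (by simp : axiomFour ∈ _)))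
  exact (hw.imp _ _).1 this h

theorem dotTwo (hw : IsWorld S4_2_1 w) {φ : ModalFormula} (h : w (dia (box φ))) :
    w (box (dia φ)) := by
  have := hw.of_mem _ (normal.substitution _ 0 φ
    (subset_smallestNormalModalLogic _ (by simp : axiomDotTwo ∈ _)))
  exact (hw.imp _ _).1 this h

theorem dotOne (hw : IsWorld S4_2_1 w) {φ : ModalFormula} (h : w (box (dia φ))) :
    w (dia (box φ)) := by
  have := hw.of_mem _ (normal.substitution _ 0 φ
    (subset_smallestNormalModalLogic _ (by simp : axiomDotOne ∈ _)))
  exact (hw.imp _ _).1 this h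

theorem dia_of_rel (hw : IsWorld S4_2_1 w) (hv : IsWorld S4_2_1 v) (h : CanonicalRel w v)
    {φ : ModalFormula} (hφ : v φ) : w (dia φ) := (hw.dia_iff normal φ).2 ⟨v, hv, h, hφ⟩

theorem of_box (hw : IsWorld S4_2_1 w) {φ : ModalFormula} (h : w (box φ)) : w φ := by
  by_contra hφ
  exact (hw.neg _).1 h (T hw ((hw.neg _).2 hφ))

theorem rel_refl (hw : IsWorld S4_2_1 w) : CanonicalRel w w := fun _ => of_box hw

theorem rel_trans {x : ModalFormula → Prop} (hw : IsWorld S4_2_1 w) (hv : IsWorld S4_2_1 v)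
    (hx : IsWorld S4_2_1 x) (hwv : CanonicalRel w v) (hvx : CanonicalRel v x) :
    CanonicalRel w x := by
  intro φ h
  by_contra hφ
  exact (hw.neg _).1 h (four hw (dia_of_rel hw hv hwv (dia_of_rel hv hx hvx ((hx.neg _).2 hφ))))

theorem box_box (hw : IsWorld S4_2_1 w) {φ : ModalFormula} (h : w (box φ)) : w (box (box φ)) :=
  (hw.box_iff normal _).2 fun _ hv hwv => (hv.box_iff normal _).2 fun _ hx hvx =>
    rel_trans hw hv hx hwv hvx _ h

/-- Formulas that are eventually necessary from `w`: the theory of the terminal world above `w`. -/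
def terminal (w : ModalFormula → Prop) (φ : ModalFormula) : Prop := w (dia (box φ))

/-- By (4), ◇□φ yields ◇□□φ, and (.2) turns this into □◇□φ. -/
theorem terminal_of_rel (hw : IsWorld S4_2_1 w) (h : CanonicalRel w v)
    {φ : ModalFormula} (hφ : terminal w φ) : terminal v φ := by
  refine h _ (dotTwo hw ?_)
  obtain ⟨x, hx, hwx, hxφ⟩ := (hw.dia_iff normal _).1 hφ
  exact dia_of_rel hw hx hwx (box_box hx hxφ)

theorem terminal_mono (hw : IsWorld S4_2_1 w) {φ ψ : ModalFormula}
    (h : ∀ x, IsWorld S4_2_1 x → x φ → x ψ) (hφ : terminal w φ) : terminal w ψ := by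
  obtain ⟨x, hx, hwx, hxφ⟩ := (hw.dia_iff normal _).1 hφ
  exact dia_of_rel hw hx hwx ((hx.box_iff normal _).2 fun y hy hxy => h y hy (hxy _ hxφ))

theorem terminal_combine (hw : IsWorld S4_2_1 w) {φ ψ : ModalFormula} (hφ : terminal w φ)
    (hψ : terminal w ψ) : ∃ x, IsWorld S4_2_1 x ∧ CanonicalRel w x ∧ x (box φ) ∧ x (box ψ) := by
  obtain ⟨x, hx, hwx, hxφ⟩ := (hw.dia_iff normal _).1 hφ
  obtain ⟨y, hy, hxy, hyψ⟩ := (hx.dia_iff normal _).1 (terminal_of_rel hw hwx hψ)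
  exact ⟨y, hy, rel_trans hw hx hy hwx hxy, hxy _ (box_box hx hxφ), hyψ⟩

theorem isWorld_terminal (hw : IsWorld S4_2_1 w) : IsWorld S4_2_1 (terminal w) where
  top := T hw (hw.of_mem _ (normal.generalization _ (normal.tautology _ fun _ h _ _ => h)))
  and α β := by
    refine ⟨fun h => ⟨terminal_mono hw (fun x hx h => ((hx.and _ _).1 h).1) h,
      terminal_mono hw (fun x hx h => ((hx.and _ _).1 h).2) h⟩, fun ⟨hα, hβ⟩ => ?_⟩
    obtain ⟨x, hx, hwx, hxα, hxβ⟩ := terminal_combine hw hα hβ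
    exact dia_of_rel hw hx hwx ((hx.box_iff normal _).2 fun _ hy hxy =>
      (hy.and _ _).2 ⟨hxy _ hxα, hxy _ hxβ⟩)
  neg α := by
    constructor
    · intro h h'
      obtain ⟨x, hx, hwx, hxα, hxβ⟩ := terminal_combine hw h h'
      exact (hx.neg _).1 (of_box hx hxα) (of_box hx hxβ)
    · intro h
      -- This is where (.1) enters: if ◇□α fails at `w`, then ◇¬α holds at every successor, so □◇¬α
      -- gives ◇□¬α.
      refine dotOne hw ((hw.box_iff normal _).2 fun v hv hwv => ?_)
      by_contra hc
      refine h (dia_of_rel hw hv hwv ((hv.box_iff normal _).2 fun x hx hvx => ?_))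
      by_contra hxα
      exact hc (dia_of_rel hv hx hvx ((hx.neg _).2 hxα))
  of_mem φ h := T hw (hw.of_mem _ (normal.generalization _ h))

/-- In the terminal theory ◇ is redundant, as it must be at a world that sees only itself. -/
theorem terminal_dia (hw : IsWorld S4_2_1 w) (φ : ModalFormula) :
    terminal w (dia φ) ↔ terminal w φ := by
  refine ⟨fun h => ?_, terminal_mono hw fun x hx => T hx⟩
  by_contra hφ
  obtain ⟨x, hx, hwx, hxα, hxβ⟩ := terminal_combine hw h
    (((isWorld_terminal hw).neg _).2 hφ)
  obtain ⟨y, hy, hxy, hyφ⟩ := (hx.dia_iff normal _).1 (of_box hx hxα)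
  exact (hy.neg _).1 (hxy _ hxβ) hyφ

/-- Completeness of S4.2.1 with respect to finite rooted preorders with a terminal world. -/
theorem exists_finite_countermodel {φ : ModalFormula} (hφ : φ ∉ S4_2_1) :
    ∃ (W : Type) (_ : Finite W) (R : W → W → Prop) (r t : W) (V : ℕ → Set W),
      (∀ w, R w w) ∧ (∀ x y z, R x y → R y z → R x z) ∧ (∀ w, R w t) ∧ (∀ w, R t w → w = t) ∧
      ¬ Forces R V r φ := by
  obtain ⟨w₀, tw₀, hw₀, hw₀φ⟩ := exists_isTruth_of_notMem normal.tautology normal.modusPonens hφ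
  have ww₀ : IsWorld S4_2_1 w₀ := ⟨tw₀, hw₀⟩
  obtain ⟨S, fS, mS, aS, nS, dS⟩ := exists_finite_subformula_closed φ
  have : Finite S := fS
  let type : (ModalFormula → Prop) → Set S := fun w => {ψ | w ψ}
  let P := {τ : Set S // ∃ w, IsWorld S4_2_1 w ∧ CanonicalRel w₀ w ∧ τ = type w}
  -- `none` is the added greatest world. Among the types, comparing only ◇-formulas makes the
  -- relation transitive; reflexivity of the canonical relation makes this comparison suffice for
  -- the truth lemma.
  let R : Option P → Option P → Prop
    | _, none => True
    | none, some _ => False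
    | some τ, some τ' => ∀ ψ (h : dia ψ ∈ S), ⟨dia ψ, h⟩ ∈ τ'.1 → ⟨dia ψ, h⟩ ∈ τ.1
  let V : ℕ → Set (Option P) := fun p =>
    {x | match x with
      | none => terminal w₀ (var p)
      | some τ => ∃ h : var p ∈ S, ⟨var p, h⟩ ∈ τ.1}
  have wU := isWorld_terminal ww₀
  have key : ∀ ψ ∈ S, (Forces R V none ψ ↔ terminal w₀ ψ) ∧
      ∀ w (hw : IsWorld S4_2_1 w) (hr : CanonicalRel w₀ w),
        Forces R V (some ⟨type w, w, hw, hr, rfl⟩) ψ ↔ w ψ := by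
    intro ψ
    induction ψ with
    | top => exact fun _ => ⟨iff_of_true trivial wU.top, fun w hw _ => iff_of_true trivial hw.top⟩
    | var p => exact fun h => ⟨Iff.rfl, fun w hw _ => ⟨fun ⟨_, h'⟩ => h', fun h' => ⟨h, h'⟩⟩⟩
    | and α β hα hβ =>
      intro h
      obtain ⟨h1, h2⟩ := aS _ _ h
      simp only [Forces, wU.and]
      exact ⟨and_congr (hα h1).1 (hβ h2).1, fun w hw hr => by
        rw [hw.and]; exact and_congr ((hα h1).2 w hw hr) ((hβ h2).2 w hw hr)⟩
    | neg α hα =>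
      intro h
      simp only [Forces, wU.neg]
      exact ⟨not_congr (hα (nS _ h)).1, fun w hw hr => by
        rw [hw.neg]; exact not_congr ((hα (nS _ h)).2 w hw hr)⟩
    | dia α hα =>
      intro h
      have ih := hα (dS _ h)
      refine ⟨?_, fun w hw hr => ⟨?_, ?_⟩⟩
      · rw [terminal_dia ww₀, ← ih.1]
        constructor
        · rintro ⟨x, hx, hxα⟩
          cases x with
          | none => exact hxα
          | some τ => exact hx.elim
        · exact fun h => ⟨none, trivial, h⟩
      · rintro ⟨x, hx, hxα⟩
        cases x with
        | none =>
          obtain ⟨y, hy, hwy, hyα⟩ := (hw.dia_iff normal _).1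
            (terminal_of_rel ww₀ hr (ih.1.1 hxα))
          exact dia_of_rel hw hy hwy (of_box hy hyα)
        | some τ =>
          obtain ⟨τ, v, hv, hrv, rfl⟩ := τ
          exact hx α h (T hv ((ih.2 v hv hrv).1 hxα))
      · intro hwα
        obtain ⟨v, hv, hwv, hvα⟩ := (hw.dia_iff normal _).1 hwα
        have hrv := rel_trans ww₀ hw hv hr hwv
        exact ⟨some ⟨type v, v, hv, hrv, rfl⟩,
          fun χ _ hχ => four hw (dia_of_rel hw hv hwv hχ), (ih.2 v hv hrv).2 hvα⟩
  refine ⟨Option P, inferInstance, R, some ⟨type w₀, w₀, ww₀, rel_refl ww₀, rfl⟩, none, V,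
    ?_, ?_, ?_, ?_, ?_⟩
  · rintro (_ | τ)
    · trivial
    · exact fun _ _ h => h
  · rintro (_ | x) (_ | y) (_ | z) h1 h2 <;>
      first | trivial | exact h1.elim | exact h2.elim | exact fun ψ h h' => h1 ψ h (h2 ψ h h')
  · rintro (_ | τ) <;> trivial
  · rintro (_ | τ) h
    · rfl
    · exact h.elim
  · rw [(key φ mS).2 w₀ ww₀ (rel_refl ww₀)]
    exact hw₀φ

end S4_2_1

-- Transfer of validity along bounded morphisms

/-- A bounded morphism for which preimages of all sets are admissible transfers the validity of
formulas from a general frame to the target frame. -/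
theorem GeneralFrame.forces_of_mem_logic {G : GeneralFrame.{u}} {φ : ModalFormula}
    (hφ : φ ∈ G.logic) {W : Type*} (R : W → W → Prop) (c : G.World → W)
    (adm : ∀ S : Set W, c ⁻¹' S ∈ G.admissible) (forth : ∀ x y, G.rel x y → R (c x) (c y))
    (back : ∀ x w, R (c x) w → ∃ y, G.rel x y ∧ c y = w) (V : ℕ → Set W) (x : G.World) :
    Forces R V (c x) φ := by
  have key : ∀ (ψ : ModalFormula) (x : G.World),
      Forces G.rel (fun p => c ⁻¹' V p) x ψ ↔ Forces R V (c x) ψ := by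
    intro ψ
    induction ψ with
    | top => exact fun _ => Iff.rfl
    | var p => exact fun _ => Iff.rfl
    | and α β hα hβ => exact fun x => and_congr (hα x) (hβ x)
    | neg α hα => exact fun x => not_congr (hα x)
    | dia α hα =>
      intro x
      constructor
      · rintro ⟨y, hxy, hy⟩
        exact ⟨c y, forth x y hxy, (hα y).1 hy⟩
      · rintro ⟨w, hxw, hw⟩
        obtain ⟨y, hxy, rfl⟩ := back x w hxw
        exact ⟨y, hxy, (hα y).2 hw⟩
  exact (key φ x).1 (hφ _ (fun p => adm (V p)) x)

open Classical in
/-- A map with values in a finite power set whose bits are admissible has admissible preimages. -/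
theorem preimage_mem_of_forall_bit {α ι : Type*} [Finite ι] (B : BooleanSubalgebra (Set α))
    (f : α → Set ι) (hf : ∀ i, {a | i ∈ f a} ∈ B) (S : Set (Set ι)) : f ⁻¹' S ∈ B := by
  have single : ∀ s : Set ι, f ⁻¹' {s} ∈ B := by
    intro s
    have : f ⁻¹' {s} = ⨅ i, (if i ∈ s then {a | i ∈ f a} else {a | i ∈ f a}ᶜ) := by
      ext a
      simp only [Set.mem_preimage, Set.mem_singleton_iff, Set.iInf_eq_iInter, Set.mem_iInter,
        Set.ext_iff]
      refine forall_congr' fun i => ?_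
      by_cases hi : i ∈ s <;> simp [hi]
    rw [this]
    refine B.iInf_mem fun i => ?_
    split_ifs
    · exact hf i
    · exact BooleanSubalgebra.compl_mem (hf i)
  have : f ⁻¹' S = ⨆ s ∈ S, f ⁻¹' {s} := by
    ext a; simp
  rw [this]
  exact B.biSup_mem (Set.toFinite S) fun s _ => single s

/-! ### Reading a world off from buttons and switches -/

section Selection

variable {W : Type*} (R : W → W → Prop) (r t : W)

/-- The maxima of the set of pushed buttons (together with the root), provided that this set is
a chain. -/
def buttonMaxima (A : Set W) : Set W :=
  {m | (∀ a ∈ insert r A, ∀ b ∈ insert r A, R a b ∨ R b a) ∧ (∀ a ∈ insert r A, R a m) ∧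
    ∃ a ∈ insert r A, R m a}

open Classical in
/-- The world given by a set `A` of pushed buttons and a set `σ` of active switches: the buttons
determine a cluster, the switches select one of its elements. -/
noncomputable def selectWorld (A σ : Set W) : W :=
  if h : (σ ∩ buttonMaxima R r A).Nonempty then h.some
  else if h : (buttonMaxima R r A).Nonempty then h.some else t

variable {R r t} {A A' σ σ' : Set W}

theorem selectWorld_mem_or (A σ : Set W) : selectWorld R r t A σ ∈ buttonMaxima R r A ∨
    (buttonMaxima R r A = ∅ ∧ selectWorld R r t A σ = t) := by
  unfold selectWorld
  split_ifs with h h'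
  · exact Or.inl h.some_mem.2
  · exact Or.inl h'.some_mem
  · exact Or.inr ⟨Set.not_nonempty_iff_eq_empty.1 h', rfl⟩

theorem buttonMaxima_nonempty [Finite W] (refl : ∀ w, R w w)
    (trans : ∀ x y z, R x y → R y z → R x z)
    (h : ∀ a ∈ insert r A, ∀ b ∈ insert r A, R a b ∨ R b a) : (buttonMaxima R r A).Nonempty := by
  suffices ∀ B : Set W, B.Finite → B ⊆ A →
      ∃ m ∈ insert r A, ∀ a ∈ insert r B, R a m by
    obtain ⟨m, hm, hmax⟩ := this A (Set.toFinite A) subset_rfl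
    exact ⟨m, h, hmax, m, hm, refl m⟩
  intro B hB
  induction B, hB using Set.Finite.induction_on with
  | empty => exact fun _ => ⟨r, by simp, by simp [refl]⟩
  | @insert b B _ _ ih =>
    intro hBA
    obtain ⟨m, hm, hmax⟩ := ih ((Set.subset_insert _ _).trans hBA)
    have hb : b ∈ insert r A := Or.inr (hBA (Or.inl rfl))
    rcases h m hm b hb with hmb | hbm
    · refine ⟨b, hb, ?_⟩
      rintro a (rfl | rfl | ha)
      · exact trans _ _ _ (hmax _ (Or.inl rfl)) hmb
      · exact refl _
      · exact trans _ _ _ (hmax _ (Or.inr ha)) hmb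
    · refine ⟨m, hm, ?_⟩
      rintro a (rfl | rfl | ha)
      · exact hmax _ (Or.inl rfl)
      · exact hbm
      · exact hmax _ (Or.inr ha)

/-- Subsets of chains are chains, and a maximum of the smaller set lies below an element of the
larger one. The switches only move within a cluster, so they may change arbitrarily. -/
theorem rel_selectWorld [Finite W] (refl : ∀ w, R w w) (trans : ∀ x y z, R x y → R y z → R x z)
    (le_top : ∀ w, R w t) (hA : A ⊆ A') :
    R (selectWorld R r t A σ) (selectWorld R r t A' σ') := by
  have hins : insert r A ⊆ insert r A' := Set.insert_subset_insert hA
  rcases selectWorld_mem_or (R := R) (r := r) (t := t) A' σ' with h' | ⟨-, h'⟩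
  · rcases selectWorld_mem_or (R := R) (r := r) (t := t) A σ with ⟨-, -, a, ha, h⟩ | ⟨h, -⟩
    · exact trans _ _ _ h (h'.2.1 a (hins ha))
    · have := buttonMaxima_nonempty refl trans
        fun a ha b hb => h'.1 a (hins ha) b (hins hb)
      simp [h] at this
  · rw [h']
    exact le_top _

theorem top_notMem_of_selectWorld_ne [Finite W] (max_top : ∀ w, R t w → w = t)
    (h : selectWorld R r t A σ ≠ t) : t ∉ A := by
  intro ht
  rcases selectWorld_mem_or (R := R) (r := r) (t := t) A σ with h' | h'
  · exact h (max_top _ (h'.2.1 t (Or.inr ht)))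
  · exact h h'.2

/-- A world above the current maximum extends the chain and becomes a maximum of it; as it is the
only active switch, the choice is forced. -/
theorem selectWorld_insert (refl : ∀ w, R w w) (trans : ∀ x y z, R x y → R y z → R x z)
    (h : selectWorld R r t A σ ≠ t) {w : W} (hw : R (selectWorld R r t A σ) w) :
    selectWorld R r t (insert w A) {w} = w := by
  rcases selectWorld_mem_or (R := R) (r := r) (t := t) A σ with ⟨h1, h2, -⟩ | h'
  · have hle : ∀ a ∈ insert r (insert w A), R a w := by
      rintro a (ha | rfl | ha)
      · exact trans _ _ _ (h2 a (Or.inl ha)) hw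
      · exact refl _
      · exact trans _ _ _ (h2 a (Or.inr ha)) hw
    have hmem : w ∈ buttonMaxima R r (insert w A) := by
      refine ⟨?_, hle, w, by simp, refl w⟩
      intro a ha b hb
      rw [Set.insert_comm] at ha hb
      rcases ha with rfl | ha
      · exact Or.inr (hle b (by rwa [Set.insert_comm]))
      · rcases hb with rfl | hb
        · exact Or.inl (hle a (by rw [Set.insert_comm]; exact Or.inr ha))
        · exact h1 a ha b hb
    have hne : ({w} ∩ buttonMaxima R r (insert w A)).Nonempty := ⟨w, rfl, hmem⟩
    unfold selectWorld
    rw [dif_pos hne]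
    exact hne.some_mem.1
  · exact (h h'.2).elim

theorem selectWorld_empty_rel (refl : ∀ w, R w w) (σ : Set W) :
    R (selectWorld R r t ∅ σ) r := by
  rcases selectWorld_mem_or (R := R) (r := r) (t := t) ∅ σ with ⟨-, -, h⟩ | ⟨h, -⟩
  · simpa using h
  · have : r ∈ buttonMaxima R r ∅ := by simp [buttonMaxima, refl]
    simp [h] at this

end Selection

/-! ### Properties of states that are expressible in CTL -/

section Definability

variable {Atom : Type v}

/-- A property of states is definable if it is expressed by a CTL state formula. -/
def Definable (Q : (T : TransitionSystem.{u, v} Atom) → T.State → Prop) : Prop :=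
  ∃ Φ : StateFormula Atom, ∀ T s, T.SatState Φ s ↔ Q T s

namespace Definable

variable {P Q : (T : TransitionSystem.{u, v} Atom) → T.State → Prop}

theorem atom (a : Atom) : Definable.{u, v} fun T s => a ∈ T.label s :=
  ⟨.atom a, fun T s => by rw [TransitionSystem.SatState]⟩

theorem and (hP : Definable P) (hQ : Definable Q) : Definable fun T s => P T s ∧ Q T s := by
  obtain ⟨Φ, hΦ⟩ := hP
  obtain ⟨Ψ, hΨ⟩ := hQ
  exact ⟨.and Φ Ψ, fun T s => by rw [TransitionSystem.SatState, hΦ, hΨ]⟩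

theorem not (hP : Definable P) : Definable fun T s => ¬ P T s := by
  obtain ⟨Φ, hΦ⟩ := hP
  exact ⟨.neg Φ, fun T s => by rw [TransitionSystem.SatState, hΦ]⟩

theorem forall_mem_list {ι : Type*} {P : ι → (T : TransitionSystem.{u, v} Atom) → T.State → Prop}
    (h : ∀ i, Definable (P i)) (l : List ι) : Definable fun T s => ∀ i ∈ l, P i T s := by
  induction l with
  | nil => exact ⟨.top, fun T s => by simp [TransitionSystem.SatState]⟩
  | cons i l ih => simpa using (h i).and ih

theorem forall_finite {ι : Type*} [Finite ι]
    {P : ι → (T : TransitionSystem.{u, v} Atom) → T.State → Prop} (h : ∀ i, Definable (P i)) :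
    Definable fun T s => ∀ i, P i T s := by
  have := Fintype.ofFinite ι
  simpa using forall_mem_list h (Finset.univ : Finset ι).toList

/-- `EX`: since every state has a successor, every transition is the start of a path. -/
theorem exists_succ (hP : Definable P) : Definable fun T s => ∃ s', T.trans s s' ∧ P T s' := by
  obtain ⟨Φ, hΦ⟩ := hP
  refine ⟨.ex (.next Φ), fun T s => ?_⟩
  simp only [TransitionSystem.SatState, TransitionSystem.SatPath, hΦ]
  constructor
  · rintro ⟨π, ⟨rfl, hπ⟩, h⟩
    exact ⟨π 1, hπ 0, h⟩
  · rintro ⟨s', hs, h⟩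
    choose next hnext using T.exists_trans
    refine ⟨fun n => Nat.casesOn n s fun n => next^[n] s', ⟨rfl, ?_⟩, h⟩
    rintro (_ | n)
    · exact hs
    · simpa only [Function.iterate_succ_apply'] using hnext (next^[n] s')

theorem forall_succ (hP : Definable P) : Definable fun T s => ∀ s', T.trans s s' → P T s' := by
  simpa using hP.not.exists_succ.not

theorem setOf_forall_init_mem (hP : Definable P) :
    {T | ∀ s ∈ T.init, P T s} ∈ BooleanSubalgebra.closure (ctlExpressible.{u, v} Atom) := by
  obtain ⟨Φ, hΦ⟩ := hP
  refine BooleanSubalgebra.subset_closure ⟨Φ, ?_⟩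
  simp only [TransitionSystem.Sat, hΦ]

theorem setOf_exists_init_mem (hP : Definable P) :
    {T | ∃ s ∈ T.init, P T s} ∈ BooleanSubalgebra.closure (ctlExpressible.{u, v} Atom) := by
  rw [← BooleanSubalgebra.compl_mem_iff]
  convert hP.not.setOf_forall_init_mem using 1
  ext T
  simp

end Definable

end Definability

/-! ### Buttons and switches for refinement -/

namespace TransitionSystem

variable {Atom : Type v} {W : Type} (p : Option W → Atom)

section Control

variable (T : TransitionSystem.{u, v} Atom)

/-- Among the atoms `p k`, exactly `p k` holds at `s`. -/
def Exactly (k : Option W) (s : T.State) : Prop := ∀ k', p k' ∈ T.label s ↔ k' = k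

/-- `s` has the label `p none` and successors with all labels. -/
def Mixed (s : T.State) : Prop :=
  T.Exactly p none s ∧ ∀ k, ∃ s', T.trans s s' ∧ T.Exactly p k s'

/-- `s` has the label `p none`, and all its successors have the label `p (some w)`. -/
def Pure (w : W) (s : T.State) : Prop :=
  T.Exactly p none s ∧ ∀ s', T.trans s s' → T.Exactly p (some w) s'

/-- Some successor of `s` is mixed. -/
def Good (s : T.State) : Prop := ∃ s', T.trans s s' ∧ T.Mixed p s'

/-- The pushed buttons: the labels that no good initial state sees in one step. -/
def buttons : Set W :=
  {w | ∀ s ∈ T.init, T.Good p s → ∀ s', T.trans s s' → ¬ T.Exactly p (some w) s'}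

/-- The active switches: some good initial state has a pure successor. -/
def switches : Set W :=
  {w | ∃ s ∈ T.init, T.Good p s ∧ ∃ s', T.trans s s' ∧ T.Pure p w s'}

end Control

variable {p} {T T' : TransitionSystem.{u, v} Atom}

theorem Exactly.unique {k k' : Option W} {s : T.State} (h : T.Exactly p k s)
    (h' : T.Exactly p k' s) : k = k' := (h' k).1 ((h k).2 rfl)

theorem Pure.not_mixed {w : W} {s : T.State} (h : T.Pure p w s) : ¬ T.Mixed p s := by
  rintro ⟨-, h'⟩
  obtain ⟨s', hs, hs'⟩ := h' none
  cases hs'.unique (h.2 s' hs)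

theorem definable_exactly [Finite W] (k : Option W) :
    Definable.{u, v} fun T s => T.Exactly p k s := by
  refine Definable.forall_finite fun k' => ?_
  by_cases h : k' = k
  · simpa [h] using Definable.atom (p k)
  · simpa [h] using (Definable.atom (p k')).not

theorem definable_good [Finite W] : Definable.{u, v} fun T s => T.Good p s :=
  Definable.exists_succ ((definable_exactly none).and
    (Definable.forall_finite fun k => (definable_exactly k).exists_succ))

theorem setOf_mem_buttons [Finite W] (w : W) :
    {T | w ∈ T.buttons p} ∈ BooleanSubalgebra.closure (ctlExpressible.{u, v} Atom) := by
  have := ((definable_good (p := p)).and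
    (definable_exactly (p := p) (some w)).exists_succ).not.setOf_forall_init_mem
  simpa [buttons] using this

theorem setOf_mem_switches [Finite W] (w : W) :
    {T | w ∈ T.switches p} ∈ BooleanSubalgebra.closure (ctlExpressible.{u, v} Atom) :=
  (definable_good.and ((definable_exactly (p := p) none).and
    (definable_exactly (some w)).forall_succ).exists_succ).setOf_exists_init_mem

/-- Buttons stay pushed under refinement. -/
theorem Refines.buttons_subset (h : Refines T T') : T.buttons p ⊆ T'.buttons p := by
  obtain ⟨-, f, -, hl, ht, hi⟩ := h
  have step : ∀ {a b}, T'.trans a b → T.trans (f a) (f b) := fun {a b} hab => by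
    rw [ht]; exact ⟨a, b, hab, rfl, rfl⟩
  have ex : ∀ {k a}, T'.Exactly p k a → T.Exactly p k (f a) := fun {k a} h => by
    simpa only [Exactly, hl] using h
  intro w hw s hs hg s' hss' hs'
  -- Goodness and seeing a label are existential, so `f` carries a counterexample in the refinement
  -- down to one in `T`.
  refine hw (f s) (hi ▸ ⟨s, hs, rfl⟩) ?_ (f s') (step hss') (ex hs')
  obtain ⟨x, hsx, hx, hxk⟩ := hg
  refine ⟨f x, step hsx, ex hx, fun k => ?_⟩
  obtain ⟨y, hxy, hy⟩ := hxk k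
  exact ⟨f y, step hxy, ex hy⟩

section Push

variable (p) (T)

/-- The states of `T`, copies of its good states, and copies of its mixed states. -/
abbrev PushState : Type u := T.State ⊕ {s // T.Good p s} ⊕ {s // T.Mixed p s}

/-- The state of `T` that is copied. -/
def pushProj : T.PushState p → T.State
  | .inl s => s
  | .inr (.inl s) => s
  | .inr (.inr s) => s

/-- The copies of good states keep their mixed successors, and they lose their pure successors
and those with the label `p (some w)`; the copies of mixed states, which are pure, become
their successors. -/
def pushTrans (w : W) : T.PushState p → T.PushState p → Prop
  | .inl s, .inl s' => T.trans s s'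
  | .inr (.inl s), .inl s' =>
    T.trans s s' ∧ (T.Mixed p s' ∨ ¬ T.Exactly p none s' ∧ ¬ T.Exactly p (some w) s')
  | .inr (.inl s), .inr (.inr s') => T.trans s s'
  | .inr (.inr s), .inl s' => T.trans s s' ∧ T.Exactly p (some w) s'
  | _, _ => False

/-- The refinement of `T` that pushes the button `w` and activates precisely the switch `w`. -/
def push (w : W) : TransitionSystem.{u, v} Atom where
  State := T.PushState p
  nonempty := T.nonempty.map .inl
  trans := T.pushTrans p w
  init := {x | match x with
    | .inl s => s ∈ T.init ∧ ¬ T.Good p s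
    | .inr (.inl s) => s.1 ∈ T.init
    | .inr (.inr _) => False}
  AP := T.AP
  label x := T.label (T.pushProj p x)
  label_subset x := T.label_subset _
  exists_trans := by
    rintro (s | ⟨s, s', h, h'⟩ | ⟨s, hs⟩)
    · obtain ⟨s', h⟩ := T.exists_trans s
      exact ⟨.inl s', h⟩
    · exact ⟨.inl s', h, Or.inl h'⟩
    · obtain ⟨s', h, h'⟩ := hs.2 (some w)
      exact ⟨.inl s', h, h'⟩

variable {T} (w : W)

theorem refines_push : Refines T (T.push p w) := by
  refine ⟨rfl, T.pushProj p, fun s => ⟨.inl s, rfl⟩, fun _ => rfl, ?_, ?_⟩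
  · ext s s'
    constructor
    · exact fun h => ⟨.inl s, .inl s', h, rfl, rfl⟩
    · rintro ⟨x | x | x, y | y | y, h, rfl, rfl⟩ <;>
        first | exact h | exact h.1 | exact h.elim
  · ext s
    constructor
    · intro h
      by_cases hg : T.Good p s
      -- Good initial states are represented by their copies alone; the originals stay as states to
      -- retain all transitions of `T`.
      · exact ⟨.inr (.inl ⟨s, hg⟩), h, rfl⟩
      · exact ⟨.inl s, ⟨h, hg⟩, rfl⟩
    · rintro ⟨x | x | x, h, rfl⟩
      exacts [h.1, h, h.elim]

theorem exactly_push {k : Option W} {x : (T.push p w).State} :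
    (T.push p w).Exactly p k x ↔ T.Exactly p k (T.pushProj p x) := Iff.rfl

theorem mixed_push_inl {s : T.State} : (T.push p w).Mixed p (.inl s) ↔ T.Mixed p s := by
  refine and_congr Iff.rfl (forall_congr' fun k => ⟨?_, ?_⟩)
  · rintro ⟨x | x | x, h, hx⟩
    exacts [⟨x, h, hx⟩, h.elim, h.elim]
  · rintro ⟨s', h, hs'⟩
    exact ⟨.inl s', h, hs'⟩

theorem good_push_inl {s : T.State} : (T.push p w).Good p (.inl s) ↔ T.Good p s := by
  constructor
  · rintro ⟨x | x | x, h, hx⟩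
    exacts [⟨x, h, (mixed_push_inl p w).1 hx⟩, h.elim, h.elim]
  · rintro ⟨s', h, hs'⟩
    exact ⟨.inl s', h, (mixed_push_inl p w).2 hs'⟩

theorem good_push_inr {s : {s // T.Good p s}} : (T.push p w).Good p (.inr (.inl s)) := by
  obtain ⟨s, s', h, h'⟩ := s
  exact ⟨.inl s', ⟨h, Or.inl h'⟩, (mixed_push_inl p w).2 h'⟩

/-- The good initial states of `T.push p w` are the copies of good initial states. -/
theorem exists_of_good_init_push {x : (T.push p w).State} (hx : x ∈ (T.push p w).init)
    (hg : (T.push p w).Good p x) : ∃ s : {s // T.Good p s}, s.1 ∈ T.init ∧ x = .inr (.inl s) := by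
  rcases x with s | s | s
  · exact (hx.2 ((good_push_inl p w).1 hg)).elim
  · exact ⟨s, hx, rfl⟩
  · exact hx.elim

theorem buttons_push : (T.push p w).buttons p = insert w (T.buttons p) := by
  ext b
  constructor
  · intro hb
    by_cases hbw : b = w
    · exact Or.inl hbw
    · refine Or.inr fun s hs hg s' hss' hs' => ?_
      -- A successor labelled by `b ≠ w` survives the push, so no button other than `w` is newly
      -- pushed.
      refine hb (.inr (.inl ⟨s, hg⟩)) hs (good_push_inr p w) (.inl s') ⟨hss', Or.inr ⟨?_, ?_⟩⟩ hs'
      · exact fun h => by cases h.unique hs'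
      · exact fun h => hbw (by cases h.unique hs'; rfl)
  · intro hb x hx hg y hxy hy
    obtain ⟨s, hs, rfl⟩ := exists_of_good_init_push p w hx hg
    rcases y with y | y | y
    · have hy' : T.Exactly p (some b) y := hy
      rcases hxy with ⟨hsy, hm | hm⟩
      · cases hm.1.unique hy'
      · rcases hb with rfl | hb
        · exact hm.2 hy'
        · exact hb s hs s.2 y hsy hy'
    · exact hxy
    · cases y.2.1.unique hy

theorem switches_push (h : ∃ s ∈ T.init, T.Good p s) : (T.push p w).switches p = {w} := by
  ext b
  constructor
  · rintro ⟨x, hx, hg, y, hxy, hy⟩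
    obtain ⟨s, hs, rfl⟩ := exists_of_good_init_push p w hx hg
    rcases y with y | y | y
    · rcases hxy with ⟨-, hm | hm⟩
      · exact (hy.not_mixed ((mixed_push_inl p w).2 hm)).elim
      · exact (hm.1 hy.1).elim
    · exact hxy.elim
    -- A mixed state sees every label, so its copy really has a successor labelled by `w`; this
    -- rules out purity for any other world.
    · obtain ⟨z, hyz, hz⟩ := y.2.2 (some w)
      cases hz.unique ((exactly_push p w).1 (hy.2 (.inl z) ⟨hyz, hz⟩))
      rfl
  · rintro rfl
    obtain ⟨s, hs, hg⟩ := h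
    obtain ⟨s', hss', hm⟩ := hg
    refine ⟨.inr (.inl ⟨s, s', hss', hm⟩), hs, good_push_inr p b, .inr (.inr ⟨s', hm⟩), hss',
      hm.1, ?_⟩
    rintro (z | z | z) hz
    exacts [hz.2, hz.elim, hz.elim]

end Push

/-- A system in which no button is pushed. -/
def unpushed (p : Option W → Atom) : TransitionSystem.{u, v} Atom where
  State := ULift (Option W)
  nonempty := ⟨⟨none⟩⟩
  trans s s' := s.down = none ∨ s = s'
  init := {⟨none⟩}
  AP := Set.range p
  label s := {p s.down}
  label_subset s := by simp
  exists_trans s := ⟨s, Or.inr rfl⟩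

theorem buttons_unpushed (hp : Function.Injective p) : (unpushed.{u, v} p).buttons p = ∅ := by
  have ex : ∀ k, (unpushed.{u, v} p).Exactly p k ⟨k⟩ := fun k k' => hp.eq_iff
  refine Set.eq_empty_of_forall_notMem fun w hw => ?_
  exact hw ⟨none⟩ rfl ⟨⟨none⟩, Or.inl rfl, ex none, fun k => ⟨⟨k⟩, Or.inl rfl, ex k⟩⟩
    ⟨some w⟩ (Or.inl rfl) (ex (some w))

end TransitionSystem

-- The bounded morphism from refinement to a finite frame

open TransitionSystem in
/-- Formulas in the modal logic of abstraction refinement hold at the root of every finite rooted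
preorder with a terminal world. -/
theorem forces_of_mem_MLAR {Atom : Type v} [Infinite Atom] {φ : ModalFormula}
    (hφ : φ ∈ MLAR.{u, v} Atom) {W : Type} [Finite W] {R : W → W → Prop} {r t : W}
    (refl : ∀ w, R w w) (trans : ∀ x y z, R x y → R y z → R x z) (le_top : ∀ w, R w t)
    (max_top : ∀ w, R t w → w = t) (V : ℕ → Set W) : Forces R V r φ := by
  let p : Option W ↪ Atom :=
    (Finite.equivFin _).toEmbedding.trans (Fin.valEmbedding.trans (Infinite.natEmbedding Atom))
  let c : TransitionSystem.{u, v} Atom → W := fun T =>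
    selectWorld R r t (T.buttons p) (T.switches p)
  have back : ∀ T w, R (c T) w → ∃ T', Refines T T' ∧ c T' = w := by
    intro T w hw
    by_cases hT : c T = t
    · refine ⟨T, ⟨rfl, id, Function.surjective_id, fun _ => rfl, ?_, by simp⟩, ?_⟩
      · ext; simp [Relation.Map]
      · rw [hT] at hw ⊢
        exact (max_top w hw).symm
    · have hgood : ∃ s ∈ T.init, T.Good p s := by
        by_contra! h
        -- Without good initial states even the button of `t` is pushed vacuously, which forces the
        -- value `t`.
        exact top_notMem_of_selectWorld_ne max_top hT fun s hs hg => (h s hs hg).elim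
      refine ⟨T.push p w, refines_push p w, ?_⟩
      simp only [c, buttons_push, switches_push p w hgood]
      exact selectWorld_insert refl trans hT hw
  have adm : ∀ S : Set W, c ⁻¹' S ∈ BooleanSubalgebra.closure (ctlExpressible.{u, v} Atom) := by
    intro S
    let f : TransitionSystem.{u, v} Atom → Set (W ⊕ W) := fun T =>
      Sum.inl '' T.buttons p ∪ Sum.inr '' T.switches p
    have : c ⁻¹' S = f ⁻¹' {s | selectWorld R r t (Sum.inl ⁻¹' s) (Sum.inr ⁻¹' s) ∈ S} := by
      ext T
      have h1 : Sum.inl ⁻¹' f T = T.buttons p := by ext; simp [f]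
      have h2 : Sum.inr ⁻¹' f T = T.switches p := by ext; simp [f]
      simp only [Set.mem_preimage, Set.mem_ofPred_eq, h1, h2, c]
    rw [this]
    refine preimage_mem_of_forall_bit _ f ?_ _
    rintro (w | w)
    · simpa [f] using setOf_mem_buttons w
    · simpa [f] using setOf_mem_switches w
  -- With no button pushed, the value is only known to see the root; the back condition then yields
  -- a refinement with value exactly `r`.
  obtain ⟨T, -, hT⟩ := back (unpushed p) r (by
    simp only [c, buttons_unpushed p.injective]
    exact selectWorld_empty_rel refl _)
  have := (refinementFrame.{u, v} Atom).forces_of_mem_logic hφ R c adm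
    (fun T T' h => rel_selectWorld refl trans le_top h.buttons_subset) back V T
  rwa [hT] at this

end AbstractionRefinement

theorem mainTheorem3 (Atom : Type v) [Infinite Atom] :
    AbstractionRefinement.MLAR.{u, v} Atom ⊆ AbstractionRefinement.S4_2_1 := by
  intro φ hφ
  by_contra h
  obtain ⟨W, _, R, r, t, V, refl, trans, le_top, max_top, hV⟩ :=
    AbstractionRefinement.S4_2_1.exists_finite_countermodel h
  exact hV (AbstractionRefinement.forces_of_mem_MLAR hφ refl trans le_top max_top V)
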